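/- Consider the one-component two-dimensional sinusoidal model $$y(t,s)=A^0\cos(\lambda^0t+\mu^0s)+B^0\sin(\lambda^0t+\mu^0s)+\epsilon(t,s),\qquad t,s=1,2,\dots$$ Let $K\subset\mathbb R$ be compact, let $\Theta=K\times K\times[0,\pi]\times[0,\pi]$, and suppose that the true parameter $\theta_0=(A^0,B^0,\lambda^0,\mu^0)$ is an interior point of $\Theta$ and that the signal is not identically zero, i.e. $(A^0,B^0)\ne(0,0)$. Suppose that the $\epsilon(t,s)$ are independent and identically distributed real random variables with $\mathbb E[\epsilon(t,s)^2]<\infty$, whose common distribution function $G$ has a unique median at $0$ (that is, $G(x)=\tfrac12$ if and only if $x=0$) and a continuous probability density $g$ that is differentiable on $\mathbb R$ with bounded derivative $g'$. For $T,S\ge 1$ let $\hat\theta_{T,S}$ be a least absolute deviation (LAD) estimator, i.e. any minimiser over $\theta=(A,B,\lambda,\mu)\in\Theta$ of $$Q_{T,S}(\theta)=\frac1{TS}\sum_{t=1}^{T}\sum_{s=1}^{S}\bigl|y(t,s)-A\cos(\lambda t+\mu s)-B\sin(\lambda t+\mu s)\bigr|.$$ Then $\hat\theta_{T,S}\to\theta_0$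 almost surely as $\min\{T,S\}\to\infty$. -/

import Mathlib

open MeasureTheory ProbabilityTheory Filter Topology

namespace LADSinusoid

/-- Parameter vectors `θ = (A, B, lam, mu)` of the one-component model. -/
abbrev Param : Type := ℝ × ℝ × ℝ × ℝ

/-- The deterministic component `A cos(lam t + mu s) + B sin(lam t + mu s)`. -/
noncomputable def signal (θ : Param) (t s : ℕ) : ℝ :=
  θ.1 * Real.cos (θ.2.2.1 * t + θ.2.2.2 * s) + θ.2.1 * Real.sin (θ.2.2.1 * t + θ.2.2.2 * s)

/-- The observations `y(t,s) = signal + noise`, at the true parameter `θ₀`.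
Only the indices `t, s ≥ 1` matter. -/
noncomputable def obs {Ω : Type*} (θ₀ : Param) (ε : ℕ → ℕ → Ω → ℝ) (t s : ℕ) (ω : Ω) : ℝ :=
  signal θ₀ t s + ε t s ω

/-- The mean absolute residual `Q_{T,S}(θ)` of a data array `y`. -/
noncomputable def meanAbsResidual (y : ℕ → ℕ → ℝ) (T S : ℕ) (θ : Param) : ℝ :=
  (1 / ((T : ℝ) * (S : ℝ))) *
    ∑ t ∈ Finset.Icc 1 T, ∑ s ∈ Finset.Icc 1 S, |y t s - signal θ t s|

/-- The parameter space `Θ = K × K × [0,π] × [0,π]`. -/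
def paramSpace (K : Set ℝ) : Set Param :=
  K ×ˢ K ×ˢ Set.Icc 0 Real.pi ×ˢ Set.Icc 0 Real.pi

/-- `θhat` is a least absolute deviation estimator over `Θ` for the random data `y`: for all
sample sizes `T, S ≥ 1` and every outcome, `θhat T S ω` is a minimiser of `Q_{T,S}` over `Θ`. -/
def IsLADEstimator {Ω : Type*} (Θ : Set Param) (y : ℕ → ℕ → Ω → ℝ)
    (θhat : ℕ → ℕ → Ω → Param) : Prop :=
  ∀ T S : ℕ, 1 ≤ T → 1 ≤ S → ∀ ω : Ω,
    θhat T S ω ∈ Θ ∧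
      IsMinOn (meanAbsResidual (fun t s => y t s ω) T S) Θ (θhat T S ω)

/-- The assumptions on the noise: the `ε(t,s)`, `t, s ≥ 1`, are independent random variables with
the common density `g`, which is continuous and differentiable with bounded derivative; the
common distribution function takes the value `1/2` at `0` and only there (so that `0` is the
unique median); and the second moment is finite. -/
structure NoiseAssumption {Ω : Type*} [MeasurableSpace Ω] (P : Measure Ω)
    (ε : ℕ → ℕ → Ω → ℝ) (g : ℝ → ℝ) : Prop where
  measurable : ∀ t s : ℕ+, Measurable (ε t s)
  indep : iIndepFun (fun (p : ℕ+ × ℕ+) => ε p.1 p.2) P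
  density_nonneg : ∀ x, 0 ≤ g x
  density_continuous : Continuous g
  law : ∀ t s : ℕ+, P.map (ε t s) = volume.withDensity (fun x => ENNReal.ofReal (g x))
  unique_median : ∀ t s : ℕ+, ∀ x : ℝ, cdf (P.map (ε t s)) x = 1 / 2 ↔ x = 0
  density_differentiable : Differentiable ℝ g
  density_deriv_bounded : ∃ M : ℝ, ∀ x, |deriv g x| ≤ M
  finite_second_moment : ∀ t s : ℕ+, MemLp (ε t s) 2 P

end LADSinusoid

/-! Let `h(t,s)` be the true signal minus the signal at `θ`. The residual sum at `θ` minus that at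
the truth is the sum of `|ε + h| - |ε|`, and this is nonpositive at a minimiser. Since `0` is the
only median, the mean of each term is nonnegative and bounded below by some `p > 0` once `|h| ≥ η`
(`exists_meanExcess_lower_bound`). The sum stays close to its mean uniformly in `θ`: Hoeffding on a
net of polynomial size in `TS`, then Borel–Cantelli over all pairs
(`ae_eventually_sum_meanExcess_le`). Hence at the estimator `|h| ≥ η` on only a small proportion of
the grid.

The deterministic half is `exists_param_separation`. A `3 × 3` block determines the frequencies and
the amplitude rotated by the phase at its corner `(a, b)`. Closeness of frequencies does not control
that phase for large `a`, `b`, so the blocks at `(a, b)` and `(2a, 2b)` are compared: the phase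
enters once as `u` and once as `u²`, and can be eliminated. -/

namespace LADSinusoid

/-! ### Identifying the parameter from most values of the signal -/

/-- The signal with complex amplitude `z`, that is `Re (z * exp (-(lam t + mu s) I))`. -/
noncomputable def complexSignal (z : ℂ) (lam mu : ℝ) (t s : ℕ) : ℝ :=
  signal (z.re, z.im, lam, mu) t s

/-- The phase factor `exp (-(lam a + mu b) I)` of a translation by `(a, b)`. -/
noncomputable def phase (lam mu : ℝ) (a b : ℕ) : ℂ :=
  ⟨Real.cos (lam * a + mu * b), -Real.sin (lam * a + mu * b)⟩

lemma norm_phase (lam mu : ℝ) (a b : ℕ) : ‖phase lam mu a b‖ = 1 := by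
  have h : Complex.normSq (phase lam mu a b) = 1 := by
    simp only [phase, Complex.normSq_apply]
    nlinarith [Real.sin_sq_add_cos_sq (lam * a + mu * b)]
  rw [Complex.normSq_eq_norm_sq] at h
  exact (pow_eq_one_iff_of_nonneg (norm_nonneg _) two_ne_zero).1 h

lemma phase_two_mul (lam mu : ℝ) (a b : ℕ) :
    phase lam mu (2 * a) (2 * b) = phase lam mu a b ^ 2 := by
  have h : lam * (2 * a : ℕ) + mu * (2 * b : ℕ) = 2 * (lam * a + mu * b) := by push_cast; ring
  apply Complex.ext
  · simp only [phase, h, pow_two, Complex.mul_re, Real.cos_two_mul']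
    ring
  · simp only [phase, h, pow_two, Complex.mul_im, Real.sin_two_mul]
    ring

/-- A shift of the block acts as a rotation of the amplitude, so every block reduces to the one at
the origin. -/
lemma complexSignal_translate (z : ℂ) (lam mu : ℝ) (a b i j : ℕ) :
    complexSignal z lam mu (a + i) (b + j) =
      complexSignal (z * phase lam mu a b) lam mu i j := by
  have h : lam * (a + i : ℕ) + mu * (b + j : ℕ) =
      (lam * a + mu * b) + (lam * i + mu * j) := by push_cast; ring
  simp only [complexSignal, signal, phase, h, Real.cos_add, Real.sin_add, Complex.mul_re,
    Complex.mul_im]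
  ring

/-- A sinusoid with frequencies in `(0, π)` is determined by its values on a `3 × 3` block. -/
lemma eq_of_complexSignal_eq {z w : ℂ} {lam mu lam₀ mu₀ : ℝ} (hw : w ≠ 0)
    (hlam₀ : lam₀ ∈ Set.Ioo 0 Real.pi) (hmu₀ : mu₀ ∈ Set.Ioo 0 Real.pi)
    (hlam : lam ∈ Set.Icc 0 Real.pi) (hmu : mu ∈ Set.Icc 0 Real.pi)
    (h : ∀ i < 3, ∀ j < 3, complexSignal z lam mu i j = complexSignal w lam₀ mu₀ i j) :
    z = w ∧ lam = lam₀ ∧ mu = mu₀ := by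
  have hsl := Real.sin_pos_of_mem_Ioo hlam₀
  have hsm := Real.sin_pos_of_mem_Ioo hmu₀
  -- Three-term recurrence: it yields `cos lam` wherever the middle value is nonzero.
  have rec1 : ∀ (z : ℂ) (lam mu : ℝ) (j : ℕ), complexSignal z lam mu 0 j +
      complexSignal z lam mu 2 j = 2 * Real.cos lam * complexSignal z lam mu 1 j := by
    intro z lam mu j
    have e : lam * (2 : ℕ) + mu * j = lam + (lam + mu * j) := by push_cast; ring
    have e' : lam * (0 : ℕ) + mu * j = (lam + mu * j) - lam := by push_cast; ring
    have e'' : lam * (1 : ℕ) + mu * j = lam + mu * j := by push_cast; ring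
    simp only [complexSignal, signal, e, e', e'']
    generalize lam + mu * (j : ℝ) = x
    rw [Real.cos_sub, Real.sin_sub, Real.cos_add, Real.sin_add]
    ring
  have rec2 : ∀ (z : ℂ) (lam mu : ℝ) (i : ℕ), complexSignal z lam mu i 0 +
      complexSignal z lam mu i 2 = 2 * Real.cos mu * complexSignal z lam mu i 1 := by
    intro z lam mu i
    have e : lam * i + mu * (2 : ℕ) = mu + (mu + lam * i) := by push_cast; ring
    have e' : lam * i + mu * (0 : ℕ) = (mu + lam * i) - mu := by push_cast; ring
    have e'' : lam * i + mu * (1 : ℕ) = mu + lam * i := by push_cast; ring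
    simp only [complexSignal, signal, e, e', e'']
    generalize mu + lam * (i : ℝ) = x
    rw [Real.cos_sub, Real.sin_sub, Real.cos_add, Real.sin_add]
    ring
  -- A nonzero sinusoid cannot vanish at two consecutive points: the determinant of the two
  -- equations is `sin lam`.
  have ne1 : ∀ (a lam : ℝ), 0 < Real.sin lam →
      ¬ (w.re * Real.cos a + w.im * Real.sin a = 0 ∧
        w.re * Real.cos (a + lam) + w.im * Real.sin (a + lam) = 0) := by
    rintro a lam hl ⟨h1, h2⟩
    rw [Real.cos_add, Real.sin_add] at h2
    have h3 : Real.sin lam * (w.im * Real.cos a - w.re * Real.sin a) = 0 := by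
      linear_combination h2 - Real.cos lam * h1
    have h4 := (mul_eq_zero.1 h3).resolve_left hl.ne'
    apply hw
    have hs := Real.sin_sq_add_cos_sq a
    apply Complex.ext
    · simp only [Complex.zero_re]
      linear_combination Real.cos a * h1 - Real.sin a * h4 - w.re * hs
    · simp only [Complex.zero_im]
      linear_combination Real.sin a * h1 + Real.cos a * h4 - w.im * hs
  have hl : Real.cos lam = Real.cos lam₀ := by
    by_contra hne
    have key : ∀ j < 3, complexSignal w lam₀ mu₀ 1 j = 0 := by
      intro j hj
      have a1 := rec1 z lam mu j
      rw [h 0 (by norm_num) j hj, h 1 (by norm_num) j hj, h 2 (by norm_num) j hj,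
        rec1 w lam₀ mu₀ j] at a1
      by_contra h0
      exact hne (mul_right_cancel₀ h0 (by linarith))
    refine ne1 lam₀ mu₀ hsm ⟨?_, ?_⟩
    · simpa [complexSignal, signal] using key 0 (by norm_num)
    · simpa [complexSignal, signal] using key 1 (by norm_num)
  have hm : Real.cos mu = Real.cos mu₀ := by
    by_contra hne
    have key : ∀ i < 3, complexSignal w lam₀ mu₀ i 1 = 0 := by
      intro j hj
      have a1 := rec2 z lam mu j
      rw [h j hj 0 (by norm_num), h j hj 1 (by norm_num), h j hj 2 (by norm_num),
        rec2 w lam₀ mu₀ j] at a1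
      by_contra h0
      exact hne (mul_right_cancel₀ h0 (by linarith))
    refine ne1 mu₀ lam₀ hsl ⟨?_, ?_⟩
    · simpa [complexSignal, signal] using key 0 (by norm_num)
    · simpa [complexSignal, signal, add_comm] using key 1 (by norm_num)
  have el := Real.injOn_cos hlam (Set.Ioo_subset_Icc_self hlam₀) hl
  have em := Real.injOn_cos hmu (Set.Ioo_subset_Icc_self hmu₀) hm
  refine ⟨?_, el, em⟩
  subst el em
  have h0 := h 0 (by norm_num) 0 (by norm_num)
  have h1 := h 1 (by norm_num) 0 (by norm_num)
  simp only [complexSignal, signal, Nat.cast_zero, Nat.cast_one, mul_zero, mul_one, add_zero,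
    Real.cos_zero, Real.sin_zero] at h0 h1
  apply Complex.ext h0
  rw [h0] at h1
  exact mul_right_cancel₀ hsl.ne' (by linarith)

/-- A quantitative form of `eq_of_complexSignal_eq`, uniform over bounded amplitudes. -/
lemma exists_block_separation {lam₀ mu₀ r : ℝ} (R : ℝ) (hr : 0 < r)
    (hlam₀ : lam₀ ∈ Set.Ioo 0 Real.pi) (hmu₀ : mu₀ ∈ Set.Ioo 0 Real.pi) {δ : ℝ} (hδ : 0 < δ) :
    ∃ η > 0, ∀ (z w : ℂ) (lam mu : ℝ), ‖z‖ ≤ R → ‖w‖ = r → lam ∈ Set.Icc 0 Real.pi →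
      mu ∈ Set.Icc 0 Real.pi →
      (∀ i < 3, ∀ j < 3, |complexSignal w lam₀ mu₀ i j - complexSignal z lam mu i j| < η) →
      ‖z - w‖ < δ ∧ |lam - lam₀| < δ ∧ |mu - mu₀| < δ := by
  -- The compact set on which the conclusion fails. `F` has no zero there by uniqueness, so it has a
  -- positive minimum; it has nine terms, whence `η / 9`.
  let C : Set (ℂ × ℂ × ℝ × ℝ) :=
    (Metric.closedBall 0 R ×ˢ Metric.sphere 0 r ×ˢ Set.Icc 0 Real.pi ×ˢ Set.Icc 0 Real.pi) ∩
      {p | δ ≤ max ‖p.1 - p.2.1‖ (max |p.2.2.1 - lam₀| |p.2.2.2 - mu₀|)}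
  have hC : IsCompact C :=
    ((isCompact_closedBall _ _).prod ((isCompact_sphere _ _).prod
      (isCompact_Icc.prod isCompact_Icc))).inter_right
      (isClosed_le continuous_const (by fun_prop))
  let F : ℂ × ℂ × ℝ × ℝ → ℝ := fun p => ∑ q ∈ Finset.range 3 ×ˢ Finset.range 3,
    |complexSignal p.2.1 lam₀ mu₀ q.1 q.2 - complexSignal p.1 p.2.2.1 p.2.2.2 q.1 q.2|
  have hF : Continuous F := by
    simp only [F, complexSignal, signal]
    fun_prop
  suffices ∃ η > 0, ∀ p ∈ C, η ≤ F p by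
    obtain ⟨η, hη, hle⟩ := this
    refine ⟨η / 9, by positivity, fun z w lam mu hz hw hlam hmu hlt => ?_⟩
    by_contra hcon
    have hmem : (z, w, lam, mu) ∈ C := by
      refine ⟨⟨by simpa using hz, by simpa using hw, hlam, hmu⟩, ?_⟩
      by_contra hlt'
      simp only [Set.mem_ofPred_eq, not_le, max_lt_iff] at hlt'
      exact hcon hlt'
    have h1 := hle _ hmem
    have h2 : F (z, w, lam, mu) < ∑ q ∈ Finset.range 3 ×ˢ Finset.range 3, η / 9 := by
      apply Finset.sum_lt_sum_of_nonempty ⟨(0, 0), by simp⟩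
      intro q hq
      simp only [Finset.mem_product, Finset.mem_range] at hq
      exact hlt _ hq.1 _ hq.2
    simp at h2
    linarith
  rcases C.eq_empty_or_nonempty with hE | hne
  · exact ⟨1, one_pos, by simp [hE]⟩
  obtain ⟨p, hp, hmin⟩ := hC.exists_isMinOn hne hF.continuousOn
  refine ⟨F p, ?_, fun q hq => hmin hq⟩
  have h0 : 0 ≤ F p := Finset.sum_nonneg fun _ _ => abs_nonneg _
  refine lt_of_le_of_ne h0 fun hz => ?_
  have hz' := (Finset.sum_eq_zero_iff_of_nonneg (fun _ _ => abs_nonneg _)).1 hz.symm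
  obtain ⟨⟨_, hw, hl, hm⟩, hsep⟩ := hp
  have hw0 : p.2.1 ≠ 0 := by
    rw [← norm_pos_iff, mem_sphere_zero_iff_norm.1 hw]
    exact hr
  obtain ⟨e1, e2, e3⟩ := eq_of_complexSignal_eq hw0 hlam₀ hmu₀ hl hm (fun i hi j hj => by
    have := hz' (i, j) (by simp [hi, hj])
    exact (sub_eq_zero.1 (abs_eq_zero.1 this)).symm)
  simp only [Set.mem_ofPred_eq, e1, e2, e3, sub_self, norm_zero, abs_zero, max_self] at hsep
  linarith

/-- If `z u ≈ w v` and `z u² ≈ w v²` for unimodular `u`, `v`, then `z ≈ w`. -/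
lemma norm_mul_norm_sub_le {z w u v : ℂ} {δ : ℝ} (hu : ‖u‖ = 1) (hv : ‖v‖ = 1)
    (h1 : ‖z * u - w * v‖ ≤ δ) (h2 : ‖z * u ^ 2 - w * v ^ 2‖ ≤ δ) :
    ‖w‖ * ‖z - w‖ ≤ (2 * ‖z‖ + ‖w‖) * δ := by
  -- Difference of squares: the `z² u²` terms cancel, which removes `u`.
  have e : w * (z - w) * v ^ 2 =
      (z * u - w * v) * (z * u + w * v) - z * (z * u ^ 2 - w * v ^ 2) := by ring
  have e1 : ‖w‖ * ‖z - w‖ = ‖w * (z - w) * v ^ 2‖ := by simp [hv]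
  have e2 : ‖z * u + w * v‖ ≤ ‖z‖ + ‖w‖ := (norm_add_le _ _).trans (by simp [hu, hv])
  rw [e1, e]
  calc _ ≤ ‖(z * u - w * v) * (z * u + w * v)‖ + ‖z * (z * u ^ 2 - w * v ^ 2)‖ :=
        norm_sub_le _ _
    _ ≤ δ * (‖z‖ + ‖w‖) + ‖z‖ * δ := by
        rw [norm_mul, norm_mul]
        gcongr
        exact (norm_nonneg _).trans h1
    _ = _ := by ring

/-- A sparse set of grid points misses the `3 × 3` blocks at some `(a, b)` and `(2a, 2b)`. -/
lemma exists_good_blocks {T S : ℕ} (hT : 6 ≤ T) (hS : 6 ≤ S) (B : Finset (ℕ × ℕ))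
    (hB : 300 * B.card < T * S) :
    ∃ a b : ℕ, 1 ≤ a ∧ 1 ≤ b ∧ 2 * a + 2 ≤ T ∧ 2 * b + 2 ≤ S ∧
      ∀ i < 3, ∀ j < 3, (a + i, b + j) ∉ B ∧ (2 * a + i, 2 * b + j) ∉ B := by
  classical
  let G := Finset.Icc 1 ((T - 2) / 2) ×ˢ Finset.Icc 1 ((S - 2) / 2)
  let I := Finset.range 3 ×ˢ Finset.range 3
  have hG : T * S ≤ 16 * G.card := by
    -- This fails at `T = 5`, hence the bound `6 ≤ T`.
    have h1 : T ≤ 4 * ((T - 2) / 2) := by omega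
    have h2 : S ≤ 4 * ((S - 2) / 2) := by omega
    have := Nat.mul_le_mul h1 h2
    simp only [G, Finset.card_product, Nat.card_Icc, Nat.add_sub_cancel]
    linarith
  by_contra! hcon
  have hsub : G ⊆ I.biUnion fun q =>
      (G.filter fun p => (p.1 + q.1, p.2 + q.2) ∈ B) ∪
      (G.filter fun p => (2 * p.1 + q.1, 2 * p.2 + q.2) ∈ B) := by
    rintro ⟨a, b⟩ hp
    have hp' := hp
    simp only [G, Finset.mem_product, Finset.mem_Icc] at hp'
    obtain ⟨i, hi, j, hj, hij⟩ := hcon a b hp'.1.1 hp'.2.1 (by omega) (by omega)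
    simp only [Finset.mem_biUnion, Finset.mem_union, Finset.mem_filter]
    refine ⟨(i, j), by simp [I, hi, hj], ?_⟩
    by_cases hb : (a + i, b + j) ∈ B
    · exact Or.inl ⟨hp, hb⟩
    · exact Or.inr ⟨hp, hij hb⟩
  -- Each of the 9 offsets spoils at most `2 |B|` corners, the two maps into `B` being injective. So
  -- `|G| ≤ 18 |B|`, while `TS ≤ 16 |G|`; and `16 * 18 = 288 < 300`.
  have hcard := (Finset.card_le_card hsub).trans (Finset.card_biUnion_le_card_mul I _ (2 * B.card)
    fun q _ => (Finset.card_union_le _ _).trans (by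
      rw [two_mul]
      apply add_le_add <;>
      · refine Finset.card_le_card_of_injOn _ (fun p hp => (Finset.mem_filter.1 hp).2) ?_
        rintro ⟨x, y⟩ _ ⟨x', y'⟩ _ h
        simp only [Prod.mk.injEq] at h ⊢
        omega))
  simp only [I, Finset.card_product, Finset.card_range] at hcard
  omega

lemma complex_norm_mk_le {A B R : ℝ} (hA : |A| ≤ R) (hB : |B| ≤ R) :
    ‖(⟨A, B⟩ : ℂ)‖ ≤ 2 * R :=
  (Complex.norm_le_abs_re_add_abs_im _).trans (by simpa [two_mul] using add_le_add hA hB)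

/-- A parameter whose signal is close to that of `θ₀` at most grid points is close to `θ₀`. -/
lemma exists_param_separation {A₀ B₀ lam₀ mu₀ R : ℝ} (hR : 0 ≤ R) (hamp : A₀ ≠ 0 ∨ B₀ ≠ 0)
    (hlam₀ : lam₀ ∈ Set.Ioo 0 Real.pi) (hmu₀ : mu₀ ∈ Set.Ioo 0 Real.pi) {δ : ℝ} (hδ : 0 < δ) :
    ∃ η > 0, ∀ (θ : Param) (T S : ℕ), |θ.1| ≤ R → |θ.2.1| ≤ R → θ.2.2.1 ∈ Set.Icc 0 Real.pi →
      θ.2.2.2 ∈ Set.Icc 0 Real.pi → 6 ≤ T → 6 ≤ S →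
      300 * ((Finset.Icc 1 T ×ˢ Finset.Icc 1 S).filter fun p =>
        η ≤ |signal (A₀, B₀, lam₀, mu₀) p.1 p.2 - signal θ p.1 p.2|).card < T * S →
      dist θ (A₀, B₀, lam₀, mu₀) < δ := by
  let w : ℂ := ⟨A₀, B₀⟩
  have hw : 0 < ‖w‖ := by
    rw [norm_pos_iff]
    intro h
    rcases hamp with h' | h'
    · exact h' (congrArg Complex.re h)
    · exact h' (congrArg Complex.im h)
  have hden : 0 < 4 * R + ‖w‖ := by positivity
  -- Rotated amplitudes stay on the sphere of radius `‖w‖`, so one `η` serves all blocks. The second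
  -- entry of the minimum makes the phase elimination give `‖z - w‖ ≤ δ / 2`.
  obtain ⟨η, hη, hsep⟩ := exists_block_separation (2 * R) hw hlam₀ hmu₀
    (δ := min δ (‖w‖ * (δ / 2) / (4 * R + ‖w‖))) (by positivity)
  refine ⟨η, hη, ?_⟩
  rintro ⟨A, B, lam, mu⟩ T S hA hB hlam hmu hT hS hcard
  dsimp only at hA hB hlam hmu
  obtain ⟨a, b, ha, hb, haT, hbS, hgood⟩ := exists_good_blocks hT hS _ hcard
  let z : ℂ := ⟨A, B⟩
  have hz : ‖z‖ ≤ 2 * R := complex_norm_mk_le hA hB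
  have good : ∀ a b : ℕ, 1 ≤ a → 1 ≤ b → a + 2 ≤ T → b + 2 ≤ S →
      (∀ i < 3, ∀ j < 3, (a + i, b + j) ∉ ((Finset.Icc 1 T ×ˢ Finset.Icc 1 S).filter fun p =>
        η ≤ |signal (A₀, B₀, lam₀, mu₀) p.1 p.2 - signal (A, B, lam, mu) p.1 p.2|)) →
      ‖z * phase lam mu a b - w * phase lam₀ mu₀ a b‖ <
          min δ (‖w‖ * (δ / 2) / (4 * R + ‖w‖)) ∧
        |lam - lam₀| < min δ (‖w‖ * (δ / 2) / (4 * R + ‖w‖)) ∧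
        |mu - mu₀| < min δ (‖w‖ * (δ / 2) / (4 * R + ‖w‖)) := by
    intro a b ha hb haT hbS h
    refine hsep _ _ lam mu (by simpa [norm_phase] using hz) (by simp [norm_phase]) hlam hmu ?_
    intro i hi j hj
    rw [← complexSignal_translate, ← complexSignal_translate]
    have := h i hi j hj
    simp only [Finset.mem_filter, Finset.mem_product, Finset.mem_Icc, not_and, not_le] at this
    exact this ⟨⟨by omega, by omega⟩, by omega, by omega⟩
  obtain ⟨g1, gl, gm⟩ := good a b ha hb (by omega) (by omega) fun i hi j hj => (hgood i hi j hj).1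
  obtain ⟨g2, -, -⟩ := good (2 * a) (2 * b) (by omega) (by omega) haT hbS
    fun i hi j hj => (hgood i hi j hj).2
  rw [phase_two_mul, phase_two_mul] at g2
  have hmul := norm_mul_norm_sub_le (norm_phase _ _ _ _) (norm_phase _ _ _ _)
    (g1.le.trans (min_le_right _ _)) (g2.le.trans (min_le_right _ _))
  have hzw : ‖z - w‖ < δ := by
    have h1 : ‖w‖ * ‖z - w‖ ≤ ‖w‖ * (δ / 2) := hmul.trans <|
      (mul_le_mul_of_nonneg_right (by linarith) (by positivity)).trans_eq
        (mul_div_cancel₀ _ hden.ne')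
    linarith [le_of_mul_le_mul_left h1 hw]
  simp only [Prod.dist_eq, Real.dist_eq, max_lt_iff]
  exact ⟨(Complex.abs_re_le_norm (z - w)).trans_lt hzw,
    (Complex.abs_im_le_norm (z - w)).trans_lt hzw,
    gl.trans_le (min_le_left _ _), gm.trans_le (min_le_left _ _)⟩

/-! ### Mean excess of the absolute value around the median -/

/-- The expected increase `E (|X + h| - |X|)` of the absolute value, for `X` of law `ν`. -/
noncomputable def meanExcess (ν : Measure ℝ) (h : ℝ) : ℝ := ∫ x, (|x + h| - |x|) ∂ν

lemma abs_abs_add_sub_abs_le (x h : ℝ) : |(|x + h| - |x|)| ≤ |h| := by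
  simpa using abs_abs_sub_abs_le_abs_sub (x + h) x

lemma integrable_abs_add_sub_abs (ν : Measure ℝ) [IsFiniteMeasure ν] (h : ℝ) :
    Integrable (fun x => |x + h| - |x|) ν :=
  Integrable.of_bound (by fun_prop) |h|
    (ae_of_all _ fun x => by simpa using abs_abs_add_sub_abs_le x h)

lemma abs_meanExcess_sub_le (ν : Measure ℝ) [IsProbabilityMeasure ν] (h k : ℝ) :
    |meanExcess ν h - meanExcess ν k| ≤ |h - k| := by
  rw [meanExcess, meanExcess, ← integral_sub (integrable_abs_add_sub_abs ν h)
    (integrable_abs_add_sub_abs ν k)]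
  have key := norm_integral_le_of_norm_le_const (μ := ν) (C := |h - k|)
    (f := fun x => |x + h| - |x| - (|x + k| - |x|)) (ae_of_all _ fun x => ?_)
  · simpa using key
  rw [Real.norm_eq_abs, sub_sub_sub_cancel_right]
  simpa using abs_abs_sub_abs_le_abs_sub (x + h) (x + k)

/-- As `A` has mass one half, the first term of the minorant integrates to zero and only the `B`
term survives. -/
lemma mul_measureReal_le_meanExcess {ν : Measure ℝ} [IsProbabilityMeasure ν] {A B : Set ℝ}
    (hA : MeasurableSet A) (hB : MeasurableSet B) (hν : ν.real A = 1 / 2) {h k : ℝ}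
    (hle : ∀ x, h * (2 * A.indicator (fun _ => (1 : ℝ)) x - 1) +
      h * B.indicator (fun _ => (1 : ℝ)) x ≤ |x + k| - |x|) :
    h * ν.real B ≤ meanExcess ν k := by
  have i1 : Integrable (A.indicator fun _ => (1 : ℝ)) ν := (integrable_const _).indicator hA
  have i2 : Integrable (B.indicator fun _ => (1 : ℝ)) ν := (integrable_const _).indicator hB
  have i3 : Integrable (fun x => h * (2 * A.indicator (fun _ => (1 : ℝ)) x - 1)) ν :=
    ((i1.const_mul 2).sub (integrable_const 1)).const_mul h
  have e : ∫ x, (h * (2 * A.indicator (fun _ => (1 : ℝ)) x - 1) +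
      h * B.indicator (fun _ => (1 : ℝ)) x) ∂ν = h * ν.real B := by
    rw [integral_add i3 (i2.const_mul h), integral_const_mul, integral_const_mul,
      integral_sub (i1.const_mul 2) (integrable_const _), integral_const_mul,
      integral_indicator_const _ hA, integral_indicator_const _ hB, hν]
    simp
  rw [← e]
  exact integral_mono (i3.add (i2.const_mul h)) (integrable_abs_add_sub_abs ν k) hle

/-- The excess is `h` for `x > 0` and at least `-h` everywhere; on `(-η/2, 0]` it equals `h + 2x ≥
0`, a gain of `h` over the crude bound. -/
lemma meanExcess_lower_bound_of_pos {ν : Measure ℝ} [IsProbabilityMeasure ν]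
    (hν : ν.real (Set.Iic 0) = 1 / 2) {h η : ℝ} (hη : 0 ≤ η) (hh : η ≤ h) :
    h * ν.real (Set.Ioc (-(η / 2)) 0) ≤ meanExcess ν h := by
  have hν' : ν.real (Set.Ioi 0) = 1 / 2 := by
    rw [← Set.compl_Iic, probReal_compl_eq_one_sub measurableSet_Iic, hν]
    norm_num
  refine mul_measureReal_le_meanExcess measurableSet_Ioi measurableSet_Ioc hν' fun x => ?_
  simp only [Set.indicator_apply, Set.mem_Ioi, Set.mem_Ioc]
  have hx := le_abs_self (x + h)
  have hx2 := abs_abs_add_sub_abs_le x h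
  rw [abs_of_nonneg (hη.trans hh), abs_le] at hx2
  by_cases h0 : 0 < x
  · rw [if_pos h0, if_neg (fun h => absurd h0 (not_lt.2 h.2)), abs_of_pos h0]
    linarith
  · by_cases h1 : -(η / 2) < x
    · rw [if_neg h0, if_pos ⟨h1, not_lt.1 h0⟩, abs_of_nonpos (not_lt.1 h0)]
      linarith
    · rw [if_neg h0, if_neg (fun h => h1 h.1)]
      linarith

lemma meanExcess_lower_bound_of_neg {ν : Measure ℝ} [IsProbabilityMeasure ν]
    (hν : ν.real (Set.Iic 0) = 1 / 2) {h η : ℝ} (hη : 0 ≤ η) (hh : η ≤ h) :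
    h * ν.real (Set.Ioc 0 (η / 2)) ≤ meanExcess ν (-h) := by
  refine mul_measureReal_le_meanExcess measurableSet_Iic measurableSet_Ioc hν fun x => ?_
  simp only [Set.indicator_apply, Set.mem_Iic, Set.mem_Ioc]
  have hx := neg_abs_le (x + -h)
  have hx2 := abs_abs_add_sub_abs_le x (-h)
  rw [abs_neg, abs_of_nonneg (hη.trans hh), abs_le] at hx2
  by_cases h0 : x ≤ 0
  · rw [if_pos h0, if_neg (fun h => absurd h0 (not_le.2 h.1)), abs_of_nonpos h0]
    linarith
  · by_cases h1 : x ≤ η / 2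
    · rw [if_neg h0, if_pos ⟨not_le.1 h0, h1⟩, abs_of_pos (not_le.1 h0)]
      linarith
    · rw [if_neg h0, if_neg (fun h => h1 h.2)]
      linarith

/-- If `0` is the only median, the mean excess is nonnegative and bounded away from `0` outside
every neighbourhood of `0`. -/
lemma exists_meanExcess_lower_bound {ν : Measure ℝ} [IsProbabilityMeasure ν]
    (hν : ∀ x, cdf ν x = 1 / 2 ↔ x = 0) {η : ℝ} (hη : 0 < η) :
    ∃ p > 0, ∀ h, 0 ≤ meanExcess ν h ∧ (η ≤ |h| → p ≤ meanExcess ν h) := by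
  have h0 : ν.real (Set.Iic 0) = 1 / 2 := by rw [← cdf_eq_real]; exact (hν 0).2 rfl
  have hIoc : ∀ a b : ℝ, a ≤ b → ν.real (Set.Ioc a b) = cdf ν b - cdf ν a := by
    intro a b hab
    rw [cdf_eq_real, cdf_eq_real, ← Set.Iic_sdiff_Iic,
      measureReal_sdiff (Set.Iic_subset_Iic.2 hab) measurableSet_Iic]
  -- A null interval ending at `0` would make its other endpoint a second median.
  have hp : ∀ a b : ℝ, a < b → (a = 0 ∨ b = 0) → 0 < ν.real (Set.Ioc a b) := by
    intro a b hab h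
    rw [hIoc a b hab.le, sub_pos]
    refine lt_of_le_of_ne (monotone_cdf ν hab.le) fun heq => ?_
    rcases h with rfl | rfl
    · exact hab.ne' ((hν b).1 (heq ▸ (hν 0).2 rfl))
    · exact hab.ne ((hν a).1 (heq ▸ (hν 0).2 rfl))
  have p1 := hp (-(η / 2)) 0 (by linarith) (Or.inr rfl)
  have p2 := hp 0 (η / 2) (by linarith) (Or.inl rfl)
  refine ⟨η * min (ν.real (Set.Ioc (-(η / 2)) 0)) (ν.real (Set.Ioc 0 (η / 2))),
    by positivity, fun h => ⟨?_, fun hh => ?_⟩⟩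
  -- Nonnegativity is the degenerate case `η = 0` of the one-sided bounds.
  · rcases le_total 0 h with hs | hs
    · exact le_trans (by positivity) (meanExcess_lower_bound_of_pos h0 le_rfl hs)
    · have := meanExcess_lower_bound_of_neg h0 le_rfl (neg_nonneg.2 hs)
      rw [neg_neg] at this
      exact le_trans (mul_nonneg (neg_nonneg.2 hs) measureReal_nonneg) this
  · rcases le_total 0 h with hs | hs
    · rw [abs_of_nonneg hs] at hh
      refine le_trans ?_ (meanExcess_lower_bound_of_pos h0 hη.le hh)
      gcongr
      exact min_le_left _ _
    · rw [abs_of_nonpos hs] at hh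
      have := meanExcess_lower_bound_of_neg h0 hη.le hh
      rw [neg_neg] at this
      exact (mul_le_mul hh (min_le_right _ _) (by positivity) (hη.le.trans hh)).trans this

/-! ### Uniform concentration over bounded parameters -/

/-- Hoeffding's inequality for the deviation of the excesses from their means. -/
lemma measureReal_excess_deviation_le {Ω ι : Type*} [MeasurableSpace Ω] {P : Measure Ω}
    [IsProbabilityMeasure P] {ν : Measure ℝ} {e : ι → Ω → ℝ} (hind : iIndepFun e P)
    (hmeas : ∀ i, Measurable (e i)) (hlaw : ∀ i, P.map (e i) = ν) (h : ι → ℝ) (s : Finset ι)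
    {M δ : ℝ} (hM : 0 < M) (hδ : 0 ≤ δ) (hh : ∀ i ∈ s, |h i| ≤ M) :
    P.real {ω | δ * s.card ≤ ∑ i ∈ s, (meanExcess ν (h i) - (|e i ω + h i| - |e i ω|))} ≤
      Real.exp (-(δ ^ 2 / (2 * M ^ 2)) * s.card) := by
  have hmean : ∀ i, ∫ ω, -(|e i ω + h i| - |e i ω|) ∂P = -meanExcess ν (h i) := by
    intro i
    rw [integral_neg, meanExcess, ← hlaw i, integral_map (hmeas i).aemeasurable (by fun_prop)]
  have hsub : ∀ i ∈ s, HasSubgaussianMGF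
      (fun ω => meanExcess ν (h i) - (|e i ω + h i| - |e i ω|)) ((‖M - -M‖₊ / 2) ^ 2) P := by
    intro i hi
    have := hasSubgaussianMGF_of_mem_Icc (μ := P) (X := fun ω => -(|e i ω + h i| - |e i ω|))
      (a := -M) (b := M) (by have := hmeas i; fun_prop) (ae_of_all _ fun ω => by
        rw [Set.mem_Icc, ← abs_le, abs_neg]
        exact (abs_abs_add_sub_abs_le _ _).trans (hh i hi))
    rw [hmean i] at this
    refine this.congr (ae_of_all _ fun ω => ?_)
    simp only
    ring
  have hind' : iIndepFun (fun i ω => meanExcess ν (h i) - (|e i ω + h i| - |e i ω|)) P :=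
    hind.comp (fun i x => meanExcess ν (h i) - (|x + h i| - |x|)) (fun i => by fun_prop)
  refine (HasSubgaussianMGF.measure_sum_ge_le_of_iIndepFun hind' hsub (by positivity)).trans_eq ?_
  congr 1
  have hc : ‖M - -M‖ = 2 * M := by
    rw [Real.norm_eq_abs, sub_neg_eq_add, ← two_mul, abs_of_pos (by positivity)]
  push_cast
  rw [hc, Finset.sum_const, nsmul_eq_mul]
  rcases Nat.eq_zero_or_pos s.card with h0 | h0
  · simp [h0]
  · have : (0 : ℝ) < s.card := by exact_mod_cast h0
    field_simp

lemma abs_signal_le (θ : Param) {R : ℝ} (hθ : ‖θ‖ ≤ R) (t s : ℕ) : |signal θ t s| ≤ 2 * R := by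
  obtain ⟨A, B, lam, mu⟩ := θ
  simp only [Prod.norm_def, Real.norm_eq_abs, max_le_iff] at hθ
  obtain ⟨hA, hB, -, -⟩ := hθ
  have hR : 0 ≤ R := (abs_nonneg _).trans hA
  refine (abs_add_le _ _).trans ?_
  rw [abs_mul, abs_mul, two_mul]
  exact add_le_add
    ((mul_le_mul hA (Real.abs_cos_le_one _) (abs_nonneg _) hR).trans_eq (mul_one _))
    ((mul_le_mul hB (Real.abs_sin_le_one _) (abs_nonneg _) hR).trans_eq (mul_one _))

/-- The Lipschitz constant grows with `t + s` because the frequencies are multiplied by the indices;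
the net must therefore be refined with the sample size. -/
lemma abs_signal_sub_le (θ θ' : Param) {R d : ℝ} (hθ' : ‖θ'‖ ≤ R) (hd : ‖θ - θ'‖ ≤ d)
    (t s : ℕ) : |signal θ t s - signal θ' t s| ≤ (2 + 2 * R * (t + s)) * d := by
  obtain ⟨A, B, lam, mu⟩ := θ
  obtain ⟨A', B', lam', mu'⟩ := θ'
  simp only [Prod.norm_def, Prod.mk_sub_mk, Real.norm_eq_abs, max_le_iff] at hθ' hd
  obtain ⟨hA', hB', -, -⟩ := hθ'
  obtain ⟨hA, hB, hl, hm⟩ := hd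
  have hR : 0 ≤ R := (abs_nonneg _).trans hA'
  have hd : 0 ≤ d := (abs_nonneg _).trans hA
  simp only [signal]
  set x := lam * (t : ℝ) + mu * s
  set y := lam' * (t : ℝ) + mu' * s
  have hxy : |x - y| ≤ (t + s) * d := by
    have e : x - y = (lam - lam') * t + (mu - mu') * s := by simp only [x, y]; ring
    rw [e]
    refine (abs_add_le _ _).trans ?_
    rw [abs_mul, abs_mul, Nat.abs_cast, Nat.abs_cast]
    nlinarith [mul_le_mul_of_nonneg_right hl (Nat.cast_nonneg (α := ℝ) t),
      mul_le_mul_of_nonneg_right hm (Nat.cast_nonneg (α := ℝ) s)]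
  have hc := (Real.abs_cos_sub_cos_le x y).trans hxy
  have hs := (Real.abs_sin_sub_sin_le x y).trans hxy
  have e : A * Real.cos x + B * Real.sin x - (A' * Real.cos y + B' * Real.sin y) =
      ((A - A') * Real.cos x + (B - B') * Real.sin x) +
        (A' * (Real.cos x - Real.cos y) + B' * (Real.sin x - Real.sin y)) := by ring
  rw [e]
  have h1 := mul_le_mul hA (Real.abs_cos_le_one x) (abs_nonneg _) hd
  have h2 := mul_le_mul hB (Real.abs_sin_le_one x) (abs_nonneg _) hd
  have h3 := mul_le_mul hA' hc (abs_nonneg _) hR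
  have h4 := mul_le_mul hB' hs (abs_nonneg _) hR
  rw [← abs_mul] at h1 h2 h3 h4
  calc _ ≤ (|(A - A') * Real.cos x| + |(B - B') * Real.sin x|) +
        (|A' * (Real.cos x - Real.cos y)| + |B' * (Real.sin x - Real.sin y)|) :=
        (abs_add_le _ _).trans (add_le_add (abs_add_le _ _) (abs_add_le _ _))
    _ ≤ (d * 1 + d * 1) + (R * ((t + s) * d) + R * ((t + s) * d)) := by gcongr
    _ = _ := by ring

lemma exists_real_net (R n : ℕ) (hn : 0 < n) :
    ∃ N : Finset ℝ, N.card ≤ 2 * R * n + 1 ∧ (∀ y ∈ N, |y| ≤ R) ∧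
      ∀ x : ℝ, |x| ≤ R → ∃ y ∈ N, |x - y| ≤ 1 / n := by
  classical
  have hn' : (0 : ℝ) < n := by exact_mod_cast hn
  refine ⟨(Finset.Icc (-(R * n : ℤ)) (R * n)).image fun k : ℤ => (k : ℝ) / n, ?_, ?_, ?_⟩
  · refine Finset.card_image_le.trans ?_
    rw [Int.card_Icc]
    have : (R * n : ℤ) + 1 - -(R * n) = ((2 * R * n + 1 : ℕ) : ℤ) := by push_cast; ring
    rw [this, Int.toNat_natCast]
  · intro y hy
    obtain ⟨k, hk, rfl⟩ := Finset.mem_image.1 hy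
    rw [Finset.mem_Icc, ← abs_le] at hk
    rw [abs_div, Nat.abs_cast, div_le_iff₀ hn']
    exact_mod_cast hk
  · intro x hx
    rw [abs_le] at hx
    refine ⟨(⌊x * n⌋ : ℝ) / n, Finset.mem_image.2 ⟨⌊x * n⌋, ?_, rfl⟩, ?_⟩
    · rw [Finset.mem_Icc]
      constructor
      · apply Int.le_floor.2
        push_cast
        nlinarith
      · have h1 := Int.floor_le (x * n)
        have h2 : x * n ≤ ((R * n : ℤ) : ℝ) := by
          push_cast
          exact mul_le_mul_of_nonneg_right hx.2 hn'.le
        exact_mod_cast h1.trans h2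
    · have e : x - (⌊x * n⌋ : ℝ) / n = Int.fract (x * n) / n := by
        rw [Int.fract]
        field_simp
      rw [e, abs_of_nonneg (div_nonneg (Int.fract_nonneg _) hn'.le)]
      gcongr
      exact (Int.fract_lt_one _).le

/-- The ball of radius `R` in the parameter space has a `1 / n`-net of size `(2 R n + 1) ^ 4`. -/
lemma exists_param_net (R n : ℕ) (hn : 0 < n) :
    ∃ N : Finset Param, N.card ≤ (2 * R * n + 1) ^ 4 ∧ (∀ θ' ∈ N, ‖θ'‖ ≤ R) ∧
      ∀ θ : Param, ‖θ‖ ≤ R → ∃ θ' ∈ N, ‖θ - θ'‖ ≤ 1 / n := by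
  obtain ⟨N, hcard, hN, hnet⟩ := exists_real_net R n hn
  refine ⟨N ×ˢ N ×ˢ N ×ˢ N, ?_, ?_, ?_⟩
  · simp only [Finset.card_product]
    calc _ = N.card ^ 4 := by ring
      _ ≤ _ := by gcongr
  · rintro ⟨A, B, lam, mu⟩ h
    simp only [Finset.mem_product] at h
    simp only [Prod.norm_def, Real.norm_eq_abs, max_le_iff]
    exact ⟨hN _ h.1, hN _ h.2.1, hN _ h.2.2.1, hN _ h.2.2.2⟩
  · rintro ⟨A, B, lam, mu⟩ h
    simp only [Prod.norm_def, Real.norm_eq_abs, max_le_iff] at h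
    obtain ⟨A', mA, hA⟩ := hnet A h.1
    obtain ⟨B', mB, hB⟩ := hnet B h.2.1
    obtain ⟨l', ml, hl⟩ := hnet lam h.2.2.1
    obtain ⟨m', mm, hm⟩ := hnet mu h.2.2.2
    refine ⟨(A', B', l', m'), by simp [mA, mB, ml, mm], ?_⟩
    simp only [Prod.norm_def, Prod.mk_sub_mk, Real.norm_eq_abs, max_le_iff]
    exact ⟨hA, hB, hl, hm⟩

lemma summable_pow_mul_exp_neg (a : ℝ) {c : ℝ} (hc : 0 < c) :
    Summable fun n : ℕ+ × ℕ+ => (a * ((n.1 : ℝ) * n.2)) ^ 4 * Real.exp (-c * ((n.1 : ℝ) * n.2)) := by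
  have h1 : Summable fun n : ℕ+ => 1 / ((n : ℕ) : ℝ) ^ 2 :=
    (Real.summable_one_div_nat_pow.2 one_lt_two).comp_injective PNat.coe_injective
  have h2 := (h1.mul_of_nonneg h1 (fun _ => by positivity) (fun _ => by positivity)).mul_left
    (a ^ 4 * (720 / c ^ 6))
  refine Summable.of_nonneg_of_le (fun _ => by positivity) (fun n => ?_) h2
  have p1 : (0 : ℝ) < n.1 := by exact_mod_cast n.1.pos
  have p2 : (0 : ℝ) < n.2 := by exact_mod_cast n.2.pos
  -- The sixth Taylor term outweighs the fourth power and leaves `(TS)⁻²`, summable over pairs.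
  have hx := Real.pow_div_factorial_le_exp (x := c * ((n.1 : ℝ) * n.2)) (by positivity) 6
  have hf : ((Nat.factorial 6 : ℕ) : ℝ) = 720 := by norm_num [Nat.factorial]
  rw [hf] at hx
  rw [neg_mul, Real.exp_neg]
  calc _ ≤ (a * ((n.1 : ℝ) * n.2)) ^ 4 * ((c * ((n.1 : ℝ) * n.2)) ^ 6 / 720)⁻¹ := by gcongr
    _ = _ := by field_simp

/-- Almost surely, for all but finitely many sample sizes, the total excess of absolute residuals
is not much smaller than its mean, uniformly over bounded parameters. -/
lemma ae_eventually_sum_meanExcess_le {Ω : Type*} [MeasurableSpace Ω] {P : Measure Ω}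
    [IsProbabilityMeasure P] {ν : Measure ℝ} [IsProbabilityMeasure ν]
    {e : ℕ+ × ℕ+ → Ω → ℝ} (hind : iIndepFun e P)
    (hmeas : ∀ i, Measurable (e i)) (hlaw : ∀ i, P.map (e i) = ν) {R : ℕ} {θ₀ : Param}
    (hR : 0 < R) (hθ₀ : ‖θ₀‖ ≤ R) {δ : ℝ} (hδ : 0 < δ) :
    ∀ᵐ ω ∂P, ∀ᶠ n : ℕ+ × ℕ+ in cofinite, ∀ θ : Param, ‖θ‖ ≤ R →
      ∑ i ∈ Finset.Icc 1 n.1 ×ˢ Finset.Icc 1 n.2,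
        (meanExcess ν (signal θ₀ i.1 i.2 - signal θ i.1 i.2) -
          (|e i ω + (signal θ₀ i.1 i.2 - signal θ i.1 i.2)| - |e i ω|)) ≤
        δ * ((n.1 : ℝ) * n.2) := by
  have hR' : (0 : ℝ) < R := by exact_mod_cast hR
  -- With mesh `1 / (m T S)` the signal moves by at most `(2 + 4R) / m ≤ δ / 4`. The excess and its
  -- mean each move by at most this, which costs `δ / 2`; the other `δ / 2` is left for Hoeffding.
  obtain ⟨m, hm⟩ := exists_nat_gt ((2 + 4 * R) / (δ / 4))
  have hm0 : (0 : ℝ) < m := lt_of_le_of_lt (by positivity) hm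
  have hm0' : 0 < m := by exact_mod_cast hm0
  have hmesh : (2 + 4 * R : ℝ) / m ≤ δ / 4 := by
    rw [div_lt_iff₀ (by positivity)] at hm
    rw [div_le_iff₀ hm0]
    linarith
  have hnet := fun n : ℕ+ × ℕ+ => exists_param_net R (m * (n.1 * n.2 : ℕ))
    (Nat.mul_pos hm0' (Nat.mul_pos n.1.pos n.2.pos))
  choose N hcard hN hNet using hnet
  let Z : ℕ+ × ℕ+ → Param → Ω → ℝ := fun n θ ω => ∑ i ∈ Finset.Icc 1 n.1 ×ˢ Finset.Icc 1 n.2,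
    (meanExcess ν (signal θ₀ i.1 i.2 - signal θ i.1 i.2) -
      (|e i ω + (signal θ₀ i.1 i.2 - signal θ i.1 i.2)| - |e i ω|))
  have hgrid : ∀ n : ℕ+ × ℕ+,
      (((Finset.Icc 1 n.1 ×ˢ Finset.Icc 1 n.2).card : ℕ) : ℝ) = (n.1 : ℝ) * n.2 := by
    intro n
    simp [Finset.card_product, PNat.card_Icc]
  let E : ℕ+ × ℕ+ → Set Ω := fun n => ⋃ θ ∈ N n, {ω | δ / 2 * ((n.1 : ℝ) * n.2) ≤ Z n θ ω}
  let c : ℝ := (δ / 2) ^ 2 / (2 * (4 * R : ℝ) ^ 2)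
  have hE : ∀ n, P (E n) ≤ ENNReal.ofReal
      (((3 * R * m : ℝ) * ((n.1 : ℝ) * n.2)) ^ 4 * Real.exp (-c * ((n.1 : ℝ) * n.2))) := by
    intro n
    have hone : ∀ θ ∈ N n, P {ω | δ / 2 * ((n.1 : ℝ) * n.2) ≤ Z n θ ω} ≤
        ENNReal.ofReal (Real.exp (-c * ((n.1 : ℝ) * n.2))) := by
      intro θ hθ
      rw [← ofReal_measureReal]
      refine ENNReal.ofReal_le_ofReal ?_
      have := measureReal_excess_deviation_le hind hmeas hlaw
        (fun i => signal θ₀ i.1 i.2 - signal θ i.1 i.2)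
        (Finset.Icc 1 n.1 ×ˢ Finset.Icc 1 n.2) (M := 4 * R) (δ := δ / 2) (by positivity)
        (by positivity) (fun i _ => (abs_sub _ _).trans (by
          linarith [abs_signal_le θ₀ hθ₀ i.1 i.2, abs_signal_le θ (hN n θ hθ) i.1 i.2]))
      rwa [hgrid n] at this
    refine (measure_biUnion_finset_le _ _).trans ((Finset.sum_le_sum hone).trans ?_)
    rw [Finset.sum_const, nsmul_eq_mul, ENNReal.ofReal_mul (by positivity)]
    gcongr
    rw [← ENNReal.ofReal_natCast]
    refine ENNReal.ofReal_le_ofReal ?_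
    have h1 : ((N n).card : ℝ) ≤ (2 * R * (m * (n.1 * n.2)) + 1) ^ 4 := by
      exact_mod_cast hcard n
    refine h1.trans ?_
    -- Absorbs the `+ 1` of the net size: `2RmTS + 1 ≤ 3RmTS`.
    have h2 : (1 : ℝ) ≤ R * m * (n.1 * n.2) := by
      have : 1 ≤ R * m * ((n.1 : ℕ) * (n.2 : ℕ)) :=
        Nat.mul_pos (Nat.mul_pos hR hm0') (Nat.mul_pos n.1.pos n.2.pos)
      exact_mod_cast this
    gcongr
    linarith
  have hsum := (summable_pow_mul_exp_neg (3 * R * m) (c := c)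
    (by positivity)).tsum_ofReal_ne_top
  have hBC := ae_finite_setOfPred_mem (ne_top_of_le_ne_top hsum (ENNReal.tsum_le_tsum hE))
  filter_upwards [hBC] with ω hω
  rw [eventually_cofinite]
  refine hω.subset fun n hn => ?_
  by_contra hnE
  apply hn
  intro θ hθ
  obtain ⟨θ', hθ', hd⟩ := hNet n θ hθ
  have hZ : Z n θ' ω < δ / 2 * ((n.1 : ℝ) * n.2) := by
    by_contra hcon
    exact hnE (Set.mem_biUnion hθ' (not_lt.1 hcon))
  have p1 : (1 : ℝ) ≤ n.1 := by exact_mod_cast n.1.pos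
  have p2 : (1 : ℝ) ≤ n.2 := by exact_mod_cast n.2.pos
  have hdiff : Z n θ ω - Z n θ' ω ≤ ∑ i ∈ Finset.Icc 1 n.1 ×ˢ Finset.Icc 1 n.2, δ / 2 := by
    simp only [Z]
    rw [← Finset.sum_sub_distrib]
    refine Finset.sum_le_sum fun i hi => ?_
    rw [Finset.mem_product, Finset.mem_Icc, Finset.mem_Icc] at hi
    have q1 : ((i.1 : ℕ) : ℝ) ≤ n.1 := by exact_mod_cast hi.1.2
    have q2 : ((i.2 : ℕ) : ℝ) ≤ n.2 := by exact_mod_cast hi.2.2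
    have hs : |signal θ i.1 i.2 - signal θ' i.1 i.2| ≤ δ / 4 := by
      refine (abs_signal_sub_le θ θ' (hN n θ' hθ') hd i.1 i.2).trans (le_trans ?_ hmesh)
      push_cast
      rw [mul_one_div, div_le_div_iff₀ (by positivity) hm0]
      have q3 : (2 + 2 * R * ((i.1 : ℕ) + (i.2 : ℕ)) : ℝ) ≤ (2 + 4 * R) * (n.1 * n.2) := by
        nlinarith [mul_nonneg (sub_nonneg.2 p1) (sub_nonneg.2 p2)]
      nlinarith
    set u := signal θ₀ i.1 i.2 - signal θ i.1 i.2
    set v := signal θ₀ i.1 i.2 - signal θ' i.1 i.2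
    have huv : |u - v| ≤ δ / 4 := by
      rw [sub_sub_sub_cancel_left, abs_sub_comm]
      exact hs
    have k1 := (le_abs_self _).trans ((abs_meanExcess_sub_le ν u v).trans huv)
    have k2 := (neg_abs_le (|e i ω + u| - |e i ω + v|))
    have k3 := abs_abs_sub_abs_le_abs_sub (e i ω + u) (e i ω + v)
    rw [add_sub_add_left_eq_sub] at k3
    linarith
  rw [Finset.sum_const, nsmul_eq_mul, hgrid n] at hdiff
  change Z n θ ω ≤ _
  linarith

/-! ### From concentration to consistency -/

lemma sum_pnat_Icc_product (T S : ℕ+) (f : ℕ → ℕ → ℝ) :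
    ∑ i ∈ Finset.Icc 1 T ×ˢ Finset.Icc 1 S, f i.1 i.2 =
      ∑ t ∈ Finset.Icc 1 (T : ℕ), ∑ s ∈ Finset.Icc 1 (S : ℕ), f t s := by
  have h : ∀ (T : ℕ+) (f : ℕ → ℝ),
      ∑ t ∈ Finset.Icc 1 (T : ℕ), f t = ∑ t ∈ Finset.Icc 1 T, f t := by
    intro T f
    refine (Finset.sum_bij (fun (t : ℕ+) _ => (t : ℕ)) (fun t ht => ?_) (fun t _ s _ h => PNat.eq h)
      (fun t ht => ?_) fun _ _ => rfl).symm
    · rw [Finset.mem_Icc] at ht ⊢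
      exact ⟨t.pos, ht.2⟩
    · rw [Finset.mem_Icc] at ht
      exact ⟨⟨t, ht.1⟩, Finset.mem_Icc.2 ⟨ht.1, ht.2⟩, rfl⟩
  rw [Finset.sum_product, h]
  exact Finset.sum_congr rfl fun t _ => (h S (f t)).symm

/-- Markov's inequality for a finite sum. -/
lemma card_filter_mul_le_sum {ι : Type*} (s : Finset ι) (f : ι → ℝ) (q : ι → Prop)
    [DecidablePred q] {p : ℝ} (hf : ∀ i ∈ s, 0 ≤ f i) (hq : ∀ i ∈ s, q i → p ≤ f i) :
    (s.filter q).card * p ≤ ∑ i ∈ s, f i := by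
  rw [← nsmul_eq_mul]
  refine (Finset.card_nsmul_le_sum (s.filter q) f p fun i hi => ?_).trans
    (Finset.sum_le_sum_of_subset_of_nonneg (Finset.filter_subset _ _) fun i hi _ => hf i hi)
  exact hq i (Finset.mem_filter.1 hi).1 (Finset.mem_filter.1 hi).2

/-- The total absolute residual at a minimiser does not exceed that at the true parameter. -/
lemma sum_excess_nonpos {Ω : Type*} {Θ : Set Param} {θ₀ : Param} (hθ₀ : θ₀ ∈ Θ)
    {ε : ℕ → ℕ → Ω → ℝ} {θhat : ℕ → ℕ → Ω → Param}
    (hθ : IsLADEstimator Θ (obs θ₀ ε) θhat) (T S : ℕ+) (ω : Ω) :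
    ∑ t ∈ Finset.Icc 1 (T : ℕ), ∑ s ∈ Finset.Icc 1 (S : ℕ),
      (|ε t s ω + (signal θ₀ t s - signal (θhat T S ω) t s)| - |ε t s ω|) ≤ 0 := by
  have h := (hθ T S T.pos S.pos ω).2 hθ₀
  have p1 : (0 : ℝ) < (T : ℕ) := by exact_mod_cast T.pos
  have p2 : (0 : ℝ) < (S : ℕ) := by exact_mod_cast S.pos
  simp only [Set.mem_ofPred_eq, meanAbsResidual, obs] at h
  have h' := le_of_mul_le_mul_left h (by positivity)
  simp only [Finset.sum_sub_distrib, sub_nonpos]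
  refine le_trans (le_of_eq ?_) (h'.trans (le_of_eq ?_))
  · refine Finset.sum_congr rfl fun t _ => Finset.sum_congr rfl fun s _ => ?_
    congr 1
    ring
  · refine Finset.sum_congr rfl fun t _ => Finset.sum_congr rfl fun s _ => ?_
    congr 1
    ring

lemma mem_Ioo_of_mem_interior_paramSpace {K : Set ℝ} {θ : Param}
    (h : θ ∈ interior (paramSpace K)) :
    θ.2.2.1 ∈ Set.Ioo 0 Real.pi ∧ θ.2.2.2 ∈ Set.Ioo 0 Real.pi := by
  rw [paramSpace, interior_prod_eq, interior_prod_eq, interior_prod_eq, interior_Icc] at h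
  exact h.2.2

lemma exists_norm_le_of_mem_paramSpace {K : Set ℝ} (hK : IsCompact K) :
    ∃ R : ℕ, 0 < R ∧ ∀ θ ∈ paramSpace K, ‖θ‖ ≤ R := by
  have hc : IsCompact (paramSpace K) := hK.prod (hK.prod (isCompact_Icc.prod isCompact_Icc))
  obtain ⟨C, hC⟩ := hc.isBounded.exists_norm_le
  obtain ⟨R, hR⟩ := exists_nat_gt (max C 0)
  refine ⟨R, ?_, fun θ hθ => (hC θ hθ).trans ((le_max_left _ _).trans hR.le)⟩
  exact_mod_cast (le_max_right _ _).trans_lt hR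

/-- A property of all but finitely many pairs of positive integers holds as soon as both entries
are large. -/
lemma eventually_comap_min_of_cofinite {q : ℕ → ℕ → Prop}
    (h : ∀ᶠ n : ℕ+ × ℕ+ in cofinite, q n.1 n.2) :
    ∀ᶠ n : ℕ × ℕ in comap (fun n : ℕ × ℕ => min n.1 n.2) atTop, q n.1 n.2 := by
  rw [eventually_cofinite] at h
  -- The first coordinate of the bound is enough: a larger minimum forces `T > b.1`.
  obtain ⟨b, hb⟩ := h.bddAbove
  rw [eventually_comap]
  filter_upwards [eventually_gt_atTop (b.1 : ℕ)] with k hk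
  rintro ⟨T, S⟩ rfl
  by_contra hq
  have hT : (b.1 : ℕ) < T := hk.trans_le (min_le_left _ _)
  have hS : 0 < S := (Nat.zero_le _).trans_lt (hk.trans_le (min_le_right _ _))
  have := (hb (a := (⟨T, (Nat.zero_le _).trans_lt hT⟩, ⟨S, hS⟩)) hq).1
  exact absurd (PNat.coe_le_coe _ _ |>.2 this) (not_le.2 hT)

end LADSinusoid

theorem theorem1 {Ω : Type*} [MeasurableSpace Ω] (P : Measure Ω) [IsProbabilityMeasure P]
    (K : Set ℝ) (hK : IsCompact K)
    (A₀ B₀ lam₀ mu₀ : ℝ)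
    (hint : (A₀, B₀, lam₀, mu₀) ∈ interior (LADSinusoid.paramSpace K))
    (hamp : A₀ ≠ 0 ∨ B₀ ≠ 0)
    (ε : ℕ → ℕ → Ω → ℝ) (g : ℝ → ℝ) (hε : LADSinusoid.NoiseAssumption P ε g)
    (θhat : ℕ → ℕ → Ω → LADSinusoid.Param)
    (hθ : LADSinusoid.IsLADEstimator (LADSinusoid.paramSpace K)
      (LADSinusoid.obs (A₀, B₀, lam₀, mu₀) ε) θhat) :
    ∀ᵐ ω ∂P, Tendsto (fun n : ℕ × ℕ => θhat n.1 n.2 ω)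
      (comap (fun n : ℕ × ℕ => min n.1 n.2) atTop) (𝓝 (A₀, B₀, lam₀, mu₀)) := by
  open LADSinusoid in
  obtain ⟨R, hR, hbound⟩ := exists_norm_le_of_mem_paramSpace hK
  obtain ⟨hlam₀, hmu₀⟩ := mem_Ioo_of_mem_interior_paramSpace hint
  have hmem := interior_subset hint
  set ν : Measure ℝ := volume.withDensity fun x => ENNReal.ofReal (g x)
  have hmeas : ∀ i : ℕ+ × ℕ+, Measurable (ε i.1 i.2) := fun i => hε.measurable i.1 i.2
  have hlaw : ∀ i : ℕ+ × ℕ+, P.map (ε i.1 i.2) = ν := fun i => hε.law i.1 i.2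
  have hprob : IsProbabilityMeasure ν :=
    hlaw (1, 1) ▸ Measure.isProbabilityMeasure_map (hmeas (1, 1)).aemeasurable
  have hmed : ∀ x, cdf ν x = 1 / 2 ↔ x = 0 := hlaw (1, 1) ▸ hε.unique_median 1 1
  -- Countably many radii, so that the exceptional null sets can be united.
  have main : ∀ k : ℕ, ∀ᵐ ω ∂P, ∀ᶠ n : ℕ × ℕ in comap (fun n : ℕ × ℕ => min n.1 n.2) atTop,
      dist (θhat n.1 n.2 ω) (A₀, B₀, lam₀, mu₀) < 1 / ((k : ℝ) + 1) := by
    intro k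
    obtain ⟨η, hη, hsep⟩ := exists_param_separation (R := R) (by positivity) hamp hlam₀ hmu₀
      (δ := 1 / ((k : ℝ) + 1)) (by positivity)
    obtain ⟨p, hp, hexc⟩ := exists_meanExcess_lower_bound hmed hη
    -- With `p / 600`, Markov leaves at most `TS / 600` points where `|h| ≥ η`, strictly below the
    -- `TS / 300` allowed.
    filter_upwards [ae_eventually_sum_meanExcess_le hε.indep hmeas hlaw hR (hbound _ hmem)
      (δ := p / 600) (by positivity)] with ω hω
    have hlarge : ∀ᶠ n : ℕ × ℕ in comap (fun n : ℕ × ℕ => min n.1 n.2) atTop,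
        6 ≤ min n.1 n.2 := tendsto_comap.eventually (eventually_ge_atTop 6)
    -- Cofinitely many pairs still include some with one small entry, so the size condition stays a
    -- premise.
    have hgoal : ∀ᶠ n : ℕ+ × ℕ+ in cofinite, 6 ≤ min (n.1 : ℕ) n.2 →
        dist (θhat n.1 n.2 ω) (A₀, B₀, lam₀, mu₀) < 1 / ((k : ℝ) + 1) := by
      filter_upwards [hω] with n hn h6
      have hΘ := (hθ n.1 n.2 n.1.pos n.2.pos ω).1
      have hnorm := hbound _ hΘ
      have hsum := hn _ hnorm
      rw [sum_pnat_Icc_product n.1 n.2 fun t s =>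
        meanExcess ν (signal (A₀, B₀, lam₀, mu₀) t s - signal (θhat n.1 n.2 ω) t s) -
          (|ε t s ω + (signal (A₀, B₀, lam₀, mu₀) t s - signal (θhat n.1 n.2 ω) t s)| -
            |ε t s ω|)] at hsum
      have hmin := sum_excess_nonpos hmem hθ n.1 n.2 ω
      simp only [Finset.sum_sub_distrib] at hsum hmin
      have hcount := card_filter_mul_le_sum (Finset.Icc 1 (n.1 : ℕ) ×ˢ Finset.Icc 1 (n.2 : ℕ))
        (fun i => meanExcess ν
          (signal (A₀, B₀, lam₀, mu₀) i.1 i.2 - signal (θhat n.1 n.2 ω) i.1 i.2))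
        (fun i => η ≤ |signal (A₀, B₀, lam₀, mu₀) i.1 i.2 - signal (θhat n.1 n.2 ω) i.1 i.2|)
        (fun i _ => (hexc _).1) (fun i _ => (hexc _).2)
      rw [Finset.sum_product] at hcount
      simp only [Prod.norm_def, Real.norm_eq_abs, max_le_iff] at hnorm
      refine hsep _ n.1 n.2 hnorm.1 hnorm.2.1 hΘ.2.2.1 hΘ.2.2.2 (h6.trans (min_le_left _ _))
        (h6.trans (min_le_right _ _)) ?_
      have hpos : (0 : ℝ) < (n.1 : ℝ) * n.2 :=
        mul_pos (by exact_mod_cast n.1.pos) (by exact_mod_cast n.2.pos)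
      rw [← Nat.cast_lt (α := ℝ)]
      push_cast
      refine lt_of_mul_lt_mul_right (a := p) ?_ hp.le
      nlinarith [mul_pos hpos hp]
    filter_upwards [eventually_comap_min_of_cofinite (q := fun T S => 6 ≤ min T S →
      dist (θhat T S ω) (A₀, B₀, lam₀, mu₀) < 1 / ((k : ℝ) + 1)) hgoal, hlarge] with n hn h6
    exact hn h6
  filter_upwards [ae_all_iff.2 main] with ω hω
  rw [Metric.tendsto_nhds]
  intro δ hδ
  obtain ⟨k, hk⟩ := exists_nat_one_div_lt hδ
  filter_upwards [hω k] with n hn using hn.trans hk
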